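/- For positive integers $i_1,\dots,i_k$ with $i_1>1$ let \[ \zeta(i_1,\dots,i_k)=\sum_{n_1>\dots>n_k\ge 1}\frac1{n_1^{i_1}\cdots n_k^{i_k}} \] be the multiple zeta value of weight $i_1+\dots+i_k$ and depth $k$, and let \[ E(2n,k)=\sum_{\substack{i_1,\dots,i_k\ge 2\text{ even}\\ i_1+\dots+i_k=2n}}\zeta(i_1,\dots,i_k) \] be the (finite) sum of all multiple zeta values with even arguments, weight $2n$ and depth $k$. Let $\zeta(s)$ be the Riemann zeta function and $B_m$ the $m$th Bernoulli number. Then for all integers $1\le k\le n$ every series $\zeta(i_1,\dots,i_k)$ occurring in $E(2n,k)$ converges, and \[ E(2n,k)=\frac1{2^{2(k-1)}}\binom{2k-1}{k}\zeta(2n)-\sum_{j=1}^{\lfloor\frac{k-1}2\rfloor}\frac1{2^{2k-3}(2j+1)B_{2j}}\binom{2k-2j-1}{k}\zeta(2j)\zeta(2n-2j). \] -/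

import Mathlib

/-- The index set of the multiple zeta series of depth `k`: the tuples of natural numbers
`m 0 > m 1 > ⋯ > m (k - 1) ≥ 1`. -/
abbrev MZVIndex (k : ℕ) : Type :=
  {m : Fin k → ℕ // StrictAnti m ∧ ∀ j, 1 ≤ m j}

/-- The general term `1 / (m 0 ^ i 0 * ⋯ * m (k - 1) ^ i (k - 1))` of the multiple zeta series. -/
noncomputable def mzvTerm {k : ℕ} (i : Fin k → ℕ) (m : MZVIndex k) : ℝ :=
  1 / ∏ j, (m.1 j : ℝ) ^ i j

/-- The multiple zeta value `ζ(i 0, …, i (k - 1))`, of depth `k` and weight `∑ j, i j`. -/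
noncomputable def multipleZeta {k : ℕ} (i : Fin k → ℕ) : ℝ :=
  ∑' m : MZVIndex k, mzvTerm i m

/-- The `k`-tuples of positive even integers with sum `w`. -/
def evenArguments (w k : ℕ) : Finset (Fin k → ℕ) :=
  (Finset.Nat.antidiagonalTuple k w).filter fun i => ∀ j, 0 < i j ∧ Even (i j)

/-- `E(w, k)`: the sum of all multiple zeta values of even arguments, weight `w` and depth `k`. -/
noncomputable def evenMZVSum (w k : ℕ) : ℝ :=
  ∑ i ∈ evenArguments w k, multipleZeta i

open Finset PowerSeries Filter Topology

/-! For fixed depth `k`, the series `F_k = ∑ E(2n,k) X^n` is the `k`-th elementary symmetric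
function of the `c X / (1 - c X)`, with `c = 1/i²`. Multiplied by `∏ (1 - c X)`, it is the `t^k`
coefficient of `∏ (1 - (1 - t) c X)`, so the product only scales the `n`-th coefficient by `(-1)^k *
n.choose k` (`coeff_sum_prod_geomTail_mul`). Truncating to `i ≤ N` and letting `N → ∞`, Euler's
product turns `∏ (1 - X/i²)` into the sinc series `S` (`tendsto_coeff_prod_one_sub`), which gives
`F_k * S` explicitly.

The two-term recurrence of the coefficients of `S` then yields a three-term recurrence in `k` for
`F_k` (`evenMZVSeries_recurrence`). Its solution is a combination of the `ζ(2n - 2j)` with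
coefficients rational multiples of `π^(2j)`, and Euler's formula for `ζ(2j)` rewrites these powers
of `π`. -/

/-! ### Generating functions for finitely many variables -/

/-- The power series `c X / (1 - c X) = ∑_{n ≥ 1} c ^ n X ^ n`. -/
noncomputable def geomTail {R : Type*} [CommRing R] (c : R) : R⟦X⟧ :=
  PowerSeries.mk fun n => if n = 0 then 0 else c ^ n

theorem one_sub_mul_geomTail {R : Type*} [CommRing R] (c : R) :
    (1 - PowerSeries.C c * PowerSeries.X) * geomTail c = PowerSeries.C c * PowerSeries.X := by
  ext n
  rw [sub_mul, one_mul, map_sub, mul_assoc, PowerSeries.coeff_C_mul, PowerSeries.coeff_C_mul]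
  rcases n with _ | _ | n
  · simp [geomTail]
  · rw [PowerSeries.coeff_succ_X_mul]
    simp [geomTail]
  · rw [PowerSeries.coeff_succ_X_mul, PowerSeries.coeff_X]
    simp [geomTail, pow_succ']

theorem coeff_sum_prod_geomTail_mul {R ι : Type*} [CommRing R] [DecidableEq ι] (c : ι → R)
    (s : Finset ι) (k n : ℕ) :
    PowerSeries.coeff n ((∑ T ∈ s.powersetCard k, ∏ i ∈ T, geomTail (c i)) *
        ∏ i ∈ s, (1 - PowerSeries.C (c i) * PowerSeries.X)) =
      (-1) ^ k * (n.choose k : R) *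
        PowerSeries.coeff n (∏ i ∈ s, (1 - PowerSeries.C (c i) * PowerSeries.X)) := by
  induction s using Finset.induction_on generalizing k n with
  | empty =>
    rcases k with _ | k
    · simp
    · rw [powersetCard_eq_empty.2 (by simp : #(∅ : Finset ι) < k + 1)]
      rcases n with _ | n <;> simp [PowerSeries.coeff_one]
  | insert a s ha ih =>
    rcases k with _ | k
    · simp
    have hsplit : ∑ T ∈ (insert a s).powersetCard (k + 1), ∏ i ∈ T, geomTail (c i) =
        ∑ T ∈ s.powersetCard (k + 1), ∏ i ∈ T, geomTail (c i) +
          geomTail (c a) * ∑ T ∈ s.powersetCard k, ∏ i ∈ T, geomTail (c i) := by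
      have hnot : ∀ T ∈ s.powersetCard k, a ∉ T := fun T hT h =>
        ha ((mem_powersetCard.1 hT).1 h)
      rw [powersetCard_succ_insert ha, sum_union, sum_image, mul_sum]
      · congr 1
        exact sum_congr rfl fun T hT => prod_insert (hnot T hT)
      · intro T hT U hU h
        rw [← erase_insert (hnot T hT), ← erase_insert (hnot U hU), h]
      · rw [disjoint_left]
        intro T hT hT'
        obtain ⟨U, -, rfl⟩ := mem_image.1 hT'
        exact ha ((mem_powersetCard.1 hT).1 (mem_insert_self a U))
    have h1 := one_sub_mul_geomTail (c a)
    rw [hsplit, prod_insert ha]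
    set A := ∑ T ∈ s.powersetCard (k + 1), ∏ i ∈ T, geomTail (c i) with hA
    set B := ∑ T ∈ s.powersetCard k, ∏ i ∈ T, geomTail (c i) with hB
    set P := ∏ i ∈ s, (1 - PowerSeries.C (c i) * PowerSeries.X) with hP
    have ihA : ∀ n, PowerSeries.coeff n (A * P) =
        (-1) ^ (k + 1) * (n.choose (k + 1) : R) * PowerSeries.coeff n P := ih (k + 1)
    have ihB : ∀ n, PowerSeries.coeff n (B * P) =
        (-1) ^ k * (n.choose k : R) * PowerSeries.coeff n P := ih k
    have h2 : (A + geomTail (c a) * B) * ((1 - PowerSeries.C (c a) * PowerSeries.X) * P) =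
        A * P - PowerSeries.C (c a) * (PowerSeries.X * (A * P)) +
          PowerSeries.C (c a) * (PowerSeries.X * (B * P)) := by
      linear_combination (B * P) * h1
    have h3 : (1 - PowerSeries.C (c a) * PowerSeries.X) * P =
        P - PowerSeries.C (c a) * (PowerSeries.X * P) := by ring
    rw [h2, h3]
    simp only [map_add, map_sub, PowerSeries.coeff_C_mul]
    rcases n with _ | n
    · simp only [PowerSeries.coeff_zero_X_mul, ihA]
      simp
    · simp only [PowerSeries.coeff_succ_X_mul, ihA, ihB, Nat.choose_succ_succ, Nat.cast_add]
      ring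

/-- Halving the exponents matches positive even tuples of sum `2n` with positive tuples of sum `n`;
`geomTail` has no constant term, so zero parts drop out. -/
theorem coeff_prod_geomTail {R : Type*} [CommRing R] {k : ℕ} (c : Fin k → R) (n : ℕ) :
    PowerSeries.coeff n (∏ j, geomTail (c j ^ 2)) =
      ∑ i ∈ evenArguments (2 * n) k, ∏ j, c j ^ i j := by
  rw [PowerSeries.coeff_prod]
  have hzero : ∀ l ∈ univ.finsuppAntidiag n,
      ¬ (∀ j : Fin k, l j ≠ 0) → ∏ j, PowerSeries.coeff (l j) (geomTail (c j ^ 2)) = 0 := by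
    intro l _ hl
    push Not at hl
    obtain ⟨j, hj⟩ := hl
    exact prod_eq_zero (mem_univ j) (by simp [geomTail, hj])
  rw [← sum_filter_of_ne (p := fun l : Fin k →₀ ℕ => ∀ j, l j ≠ 0)
    fun l hl h => not_not.1 fun h' => h (hzero l hl h')]
  refine sum_bij' (fun l _ j => 2 * l j)
    (fun i _ => Finsupp.equivFunOnFinite.symm fun j => i j / 2) ?_ ?_ ?_ ?_ ?_
  · intro l hl
    simp only [mem_filter, mem_finsuppAntidiag'] at hl
    simp only [evenArguments, mem_filter, Finset.Nat.mem_antidiagonalTuple, ← mul_sum]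
    refine ⟨?_, fun j => ⟨by have := hl.2 j; lia, even_two_mul _⟩⟩
    rw [← hl.1.1, Finsupp.sum_fintype _ _ (by simp)]
  · intro i hi
    simp only [evenArguments, mem_filter, Finset.Nat.mem_antidiagonalTuple] at hi
    simp only [mem_filter, mem_finsuppAntidiag, subset_univ, and_true]
    refine ⟨?_, fun j => ?_⟩
    · have : 2 * ∑ j, i j / 2 = 2 * n := by
        rw [← hi.1, mul_sum]
        exact sum_congr rfl fun j _ => Nat.two_mul_div_two_of_even (hi.2 j).2
      simpa using this
    · obtain ⟨h1, h2⟩ := hi.2 j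
      simp only [Finsupp.equivFunOnFinite_symm_apply_apply]
      rw [Nat.even_iff] at h2
      lia
  · intro l _
    ext j
    simp
  · intro i hi
    simp only [evenArguments, mem_filter] at hi
    ext j
    simpa using Nat.two_mul_div_two_of_even (hi.2 j).2
  · intro l hl
    refine prod_congr rfl fun j _ => ?_
    simp [geomTail, (mem_filter.1 hl).2 j, pow_mul]

/-! ### Truncation and convergence of the multiple zeta series -/

/-- The indices of the multiple zeta series of depth `k` whose entries are at most `N`. -/
noncomputable def boundedMZVIndex (k N : ℕ) : Finset (MZVIndex k) :=
  haveI := Classical.decPred fun m : Fin k → ℕ => StrictAnti m ∧ ∀ j, 1 ≤ m j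
  (Fintype.piFinset fun _ => range (N + 1)).subtype _

theorem mem_boundedMZVIndex {k N : ℕ} {m : MZVIndex k} :
    m ∈ boundedMZVIndex k N ↔ ∀ j, m.1 j ≤ N := by
  simp [boundedMZVIndex]

theorem sum_boundedMZVIndex {R : Type*} [CommRing R] (k N : ℕ) (f : ℕ → R) :
    ∑ m ∈ boundedMZVIndex k N, ∏ j, f (m.1 j) =
      ∑ T ∈ (Icc 1 N).powersetCard k, ∏ i ∈ T, f i := by
  -- A strictly decreasing tuple is determined by its set of values; `rev` turns the increasing
  -- enumeration of that set into a decreasing one.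
  refine sum_bij' (fun m _ => univ.image m.1)
    (fun T hT => ⟨fun j => T.orderEmbOfFin (mem_powersetCard.1 hT).2 j.rev, fun a b hab => ?_,
      fun j => ?_⟩) ?_ ?_ ?_ ?_ ?_
  · simpa using hab
  · exact (mem_Icc.1 ((mem_powersetCard.1 hT).1
      (T.orderEmbOfFin_mem (mem_powersetCard.1 hT).2 j.rev))).1
  · intro m hm
    rw [mem_boundedMZVIndex] at hm
    rw [mem_powersetCard]
    refine ⟨fun x hx => ?_, ?_⟩
    · obtain ⟨j, -, rfl⟩ := mem_image.1 hx
      exact mem_Icc.2 ⟨m.2.2 j, hm j⟩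
    · rw [card_image_of_injective _ m.2.1.injective, card_univ, Fintype.card_fin]
  · intro T hT
    rw [mem_boundedMZVIndex]
    exact fun j => (mem_Icc.1 ((mem_powersetCard.1 hT).1
      (T.orderEmbOfFin_mem (mem_powersetCard.1 hT).2 j.rev))).2
  · intro m hm
    have hc : (univ.image m.1).card = k := by
      rw [card_image_of_injective _ m.2.1.injective, card_univ, Fintype.card_fin]
    have h : (fun j => m.1 j.rev) = (univ.image m.1).orderEmbOfFin hc :=
      orderEmbOfFin_unique hc (fun j => mem_image_of_mem _ (mem_univ _))
        fun a b hab => m.2.1 (by simpa using hab)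
    apply Subtype.ext
    funext j
    have := congrFun h j.rev
    simpa using this.symm
  · intro T hT
    have hT' := (mem_powersetCard.1 hT).2
    ext x
    have h := T.range_orderEmbOfFin hT'
    rw [Set.ext_iff] at h
    rw [← mem_coe (s := T), ← h x]
    simp only [mem_image, mem_univ, true_and, Set.mem_range]
    exact ⟨fun ⟨j, hj⟩ => ⟨j.rev, hj⟩, fun ⟨j, hj⟩ => ⟨j.rev, by simpa using hj⟩⟩
  · intro m _
    rw [prod_image m.2.1.injective.injOn]

theorem sum_evenArguments_bounded (n k N : ℕ) :
    ∑ i ∈ evenArguments (2 * n) k, ∑ m ∈ boundedMZVIndex k N, mzvTerm i m =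
      PowerSeries.coeff n
        (∑ T ∈ (Icc 1 N).powersetCard k, ∏ i ∈ T, geomTail (((i : ℝ)⁻¹) ^ 2)) := by
  rw [← sum_boundedMZVIndex k N fun i => geomTail (((i : ℝ)⁻¹) ^ 2), sum_comm, map_sum]
  refine sum_congr rfl fun m _ => ?_
  rw [coeff_prod_geomTail]
  refine sum_congr rfl fun i _ => ?_
  simp [mzvTerm]

theorem summable_inv_sq : Summable fun n : ℕ => ((n : ℝ)⁻¹) ^ 2 := by
  simp [inv_pow]

theorem mzvTerm_nonneg {k : ℕ} (i : Fin k → ℕ) (m : MZVIndex k) : 0 ≤ mzvTerm i m := by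
  unfold mzvTerm
  positivity

/-- Lowering every exponent to 2 and dropping the order condition bounds all finite sums by `(∑
1/n²)^k`. -/
theorem summable_mzvTerm {k : ℕ} {i : Fin k → ℕ} (hi : ∀ j, 2 ≤ i j) :
    Summable (mzvTerm i) := by
  classical
  refine summable_of_sum_le (c := (∑' n : ℕ, ((n : ℝ)⁻¹) ^ 2) ^ k) (mzvTerm_nonneg i) fun u => ?_
  let N := (u.sup fun m => univ.sup m.1) + 1
  have hN : ∀ m ∈ u, ∀ j, m.1 j ∈ range N := fun m hm j =>
    mem_range.2 (Nat.lt_succ_of_le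
      ((le_sup (f := m.1) (mem_univ j)).trans (le_sup (f := fun m => univ.sup m.1) hm)))
  calc ∑ m ∈ u, mzvTerm i m
      ≤ ∑ m ∈ u, ∏ j, (((m.1 j : ℕ) : ℝ)⁻¹) ^ 2 := by
        refine sum_le_sum fun m _ => ?_
        rw [mzvTerm, one_div, ← prod_inv_distrib]
        refine prod_le_prod (fun j _ => by positivity) fun j _ => ?_
        rw [← inv_pow]
        have h1 : (1 : ℝ) ≤ m.1 j := by exact_mod_cast m.2.2 j
        exact pow_le_pow_of_le_one (by positivity) (inv_le_one_of_one_le₀ h1) (hi j)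
    _ = ∑ m ∈ u.map (Function.Embedding.subtype _), ∏ j, ((m j : ℝ)⁻¹) ^ 2 := by
        rw [sum_map]
        rfl
    _ ≤ ∑ m ∈ Fintype.piFinset fun _ : Fin k => range N, ∏ j, ((m j : ℝ)⁻¹) ^ 2 := by
        refine sum_le_sum_of_subset_of_nonneg ?_ fun m _ _ => by positivity
        intro m hm
        obtain ⟨m', hm', rfl⟩ := mem_map.1 hm
        exact Fintype.mem_piFinset.2 (hN m' hm')
    _ = (∑ n ∈ range N, ((n : ℝ)⁻¹) ^ 2) ^ k := by
        rw [sum_prod_piFinset (range N) fun _ n => ((n : ℝ)⁻¹) ^ 2]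
        simp
    _ ≤ _ := by
        gcongr
        exact summable_inv_sq.sum_le_tsum _ fun n _ => by positivity

theorem two_le_of_mem_evenArguments {w k : ℕ} {i : Fin k → ℕ} (hi : i ∈ evenArguments w k)
    (j : Fin k) : 2 ≤ i j := by
  obtain ⟨h1, h2⟩ := (mem_filter.1 hi).2 j
  rw [Nat.even_iff] at h2
  lia

theorem tendsto_boundedMZVIndex (k : ℕ) : Tendsto (boundedMZVIndex k) atTop atTop := by
  refine tendsto_atTop_finset_of_monotone (fun M N h m hm => ?_) fun m => ?_
  · exact mem_boundedMZVIndex.2 fun j => (mem_boundedMZVIndex.1 hm j).trans h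
  · exact ⟨univ.sup m.1, mem_boundedMZVIndex.2 fun j => le_sup (f := m.1) (mem_univ j)⟩

theorem tendsto_evenMZVSum (n k : ℕ) :
    Tendsto (fun N => PowerSeries.coeff n
        (∑ T ∈ (Icc 1 N).powersetCard k, ∏ i ∈ T, geomTail (((i : ℕ) : ℝ)⁻¹ ^ 2)))
      atTop (𝓝 (evenMZVSum (2 * n) k)) := by
  refine Tendsto.congr (fun N => sum_evenArguments_bounded n k N) ?_
  exact tendsto_finsetSum _ fun i hi =>
    (summable_mzvTerm (two_le_of_mem_evenArguments hi)).hasSum.comp (tendsto_boundedMZVIndex k)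

/-! ### Coefficientwise limit of Euler's sine product -/

theorem coeff_prod_one_add_nonneg {ι : Type*} [DecidableEq ι] (s : Finset ι) (c : ι → ℝ)
    (hc : ∀ i ∈ s, 0 ≤ c i) (n : ℕ) :
    0 ≤ PowerSeries.coeff n (∏ i ∈ s, (1 + PowerSeries.C (c i) * PowerSeries.X)) := by
  rw [PowerSeries.coeff_prod]
  refine sum_nonneg fun l _ => prod_nonneg fun i hi => ?_
  rw [map_add, PowerSeries.coeff_C_mul, PowerSeries.coeff_one, PowerSeries.coeff_X]
  have := hc i hi
  split_ifs <;> simp <;> linarith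

theorem coeff_prod_one_sub {ι R : Type*} [CommRing R] [DecidableEq ι] (s : Finset ι) (c : ι → R)
    (n : ℕ) :
    PowerSeries.coeff n (∏ i ∈ s, (1 - PowerSeries.C (c i) * PowerSeries.X)) =
      (-1) ^ n * PowerSeries.coeff n (∏ i ∈ s, (1 + PowerSeries.C (c i) * PowerSeries.X)) := by
  rw [← PowerSeries.coeff_rescale, map_prod (PowerSeries.rescale (-1 : R))]
  congr 1
  refine prod_congr rfl fun i _ => ?_
  ext m
  rw [PowerSeries.coeff_rescale, map_sub, map_add, PowerSeries.coeff_C_mul, PowerSeries.coeff_one,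
    PowerSeries.coeff_X]
  rcases m with _ | _ | m <;> simp

theorem coeff_prod_one_add_eq {ι R : Type*} [CommRing R] [DecidableEq ι] (s : Finset ι)
    (c : ι → R) (n : ℕ) :
    PowerSeries.coeff n (∏ i ∈ s, (1 + PowerSeries.C (c i) * PowerSeries.X)) =
      (∏ i ∈ s, (1 + Polynomial.C (c i) * Polynomial.X)).coeff n := by
  rw [← Polynomial.coeff_coe]
  congr 1
  rw [← Polynomial.coeToPowerSeries.ringHom_apply, map_prod]
  simp

theorem hasSum_coeff_prod_one_add {ι : Type*} [DecidableEq ι] (s : Finset ι) (c : ι → ℝ) (x : ℝ) :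
    HasSum (fun n => PowerSeries.coeff n
        (∏ i ∈ s, (1 + PowerSeries.C (c i) * PowerSeries.X)) * x ^ n)
      (∏ i ∈ s, (1 + c i * x)) := by
  simp only [coeff_prod_one_add_eq]
  have h : ∏ i ∈ s, (1 + c i * x) =
      (∏ i ∈ s, (1 + Polynomial.C (c i) * Polynomial.X)).eval x := by
    simp [Polynomial.eval_prod]
  rw [h, Polynomial.eval_eq_sum_range]
  refine hasSum_sum_of_ne_finset_zero fun n hn => ?_
  rw [Polynomial.coeff_eq_zero_of_natDegree_lt (by simpa using hn), zero_mul]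

theorem coeff_prod_one_add_le {ι : Type*} [DecidableEq ι] (s : Finset ι) (c : ι → ℝ)
    (hc : ∀ i ∈ s, 0 ≤ c i) (n : ℕ) :
    PowerSeries.coeff n (∏ i ∈ s, (1 + PowerSeries.C (c i) * PowerSeries.X)) ≤
      Real.exp (∑ i ∈ s, c i) := by
  have h := hasSum_coeff_prod_one_add s c 1
  simp only [one_pow, mul_one] at h
  refine (le_hasSum h n fun m _ => coeff_prod_one_add_nonneg s c hc m).trans ?_
  rw [Real.exp_sum]
  exact prod_le_prod (fun i hi => by linarith [hc i hi]) fun i _ => by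
    linarith [Real.add_one_le_exp (c i)]

/-- Bounded coefficients give an analytic function near 0, and its zeros accumulate at 0 from the
right. -/
theorem eq_zero_of_hasSum_pow_zero {d : ℕ → ℝ} {M : ℝ} (hM : ∀ n, |d n| ≤ M)
    (hd : ∀ x : ℝ, 0 < x → x < 1 → HasSum (fun n => d n * x ^ n) 0) (n : ℕ) : d n = 0 := by
  let p := FormalMultilinearSeries.ofScalars ℝ d
  have hr : (1 : ENNReal) ≤ p.radius := by
    refine p.le_radius_of_bound M (r := 1) fun n => ?_
    simpa [p, FormalMultilinearSeries.ofScalars_norm] using hM n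
  have hp : HasFPowerSeriesAt p.sum p 0 :=
    (p.hasFPowerSeriesOnBall (one_pos.trans_le hr)).hasFPowerSeriesAt
  have hf : ∀ x : ℝ, 0 < x → x < 1 → p.sum x = 0 := fun x h0 h1 => by
    rw [← (hd x h0 h1).tsum_eq]
    simp [p, FormalMultilinearSeries.sum, mul_comm]
  have hfreq : ∃ᶠ x in 𝓝[≠] (0 : ℝ), p.sum x = 0 := by
    have h : ∀ᶠ x in 𝓝[>] (0 : ℝ), p.sum x = 0 := by
      filter_upwards [Ioo_mem_nhdsGT (zero_lt_one' ℝ)] with x hx using hf x hx.1 hx.2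
    exact h.frequently.filter_mono (nhdsWithin_mono _ fun x hx => ne_of_gt hx)
  have h0 := (hp.analyticAt.frequently_zero_iff_eventually_zero).1 hfreq
  have := (hp.congr h0).eq_zero
  exact congrFun ((FormalMultilinearSeries.ofScalars_series_eq_zero ℝ (c := d)).1 this) n

/-- The coefficients of `sin (π √x) / (π √x)`. -/
noncomputable def sincCoeff (n : ℕ) : ℝ := (-1) ^ n * Real.pi ^ (2 * n) / (2 * n + 1).factorial

theorem hasSum_sincCoeff {y : ℝ} (hy : y ≠ 0) :
    HasSum (fun n => sincCoeff n * (y ^ 2) ^ n) (Real.sin (Real.pi * y) / (Real.pi * y)) := by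
  have h := (Real.hasSum_sin (Real.pi * y)).div_const (Real.pi * y)
  have hy' : Real.pi * y ≠ 0 := mul_ne_zero Real.pi_ne_zero hy
  refine (funext fun n => ?_ : (fun n => sincCoeff n * (y ^ 2) ^ n) = _) ▸ h
  rw [sincCoeff]
  field_simp
  ring

theorem tendsto_prod_one_sub {y : ℝ} (hy : y ≠ 0) :
    Tendsto (fun N : ℕ => ∏ i ∈ Icc 1 N, (1 - ((i : ℕ) : ℝ)⁻¹ ^ 2 * y ^ 2)) atTop
      (𝓝 (Real.sin (Real.pi * y) / (Real.pi * y))) := by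
  have h := (Real.tendsto_euler_sin_prod y).div_const (Real.pi * y)
  have hne : Real.pi * y ≠ 0 := mul_ne_zero Real.pi_ne_zero hy
  refine h.congr fun N => ?_
  have hIcc : Icc 1 N = Ico (0 + 1) (N + 1) := by rfl
  rw [mul_div_cancel_left₀ _ hne, range_eq_Ico, hIcc,
    ← prod_Ico_add' (fun i : ℕ => (1 - (i : ℝ)⁻¹ ^ 2 * y ^ 2)) 0 N 1]
  refine prod_congr rfl fun j _ => ?_
  rw [Nat.cast_add_one, inv_pow, inv_mul_eq_div]

/-- Euler's product gives only pointwise convergence. Without their signs the coefficients increase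
with `N` and are bounded, so they have limits; dominated convergence identifies the limiting series
with sinc on `(0, 1)`, and uniqueness of coefficients finishes. -/
theorem tendsto_coeff_prod_one_sub (n : ℕ) :
    Tendsto (fun N : ℕ => PowerSeries.coeff n
        (∏ i ∈ Icc 1 N, (1 - PowerSeries.C (((i : ℕ) : ℝ)⁻¹ ^ 2) * PowerSeries.X)))
      atTop (𝓝 (sincCoeff n)) := by
  let q : ℕ → ℕ → ℝ := fun N n => PowerSeries.coeff n
        (∏ i ∈ Icc 1 N, (1 + PowerSeries.C (((i : ℕ) : ℝ)⁻¹ ^ 2) * PowerSeries.X))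
  let M := Real.exp (∑' n : ℕ, ((n : ℝ)⁻¹) ^ 2)
  have hq0 : ∀ N n, 0 ≤ q N n := fun N n =>
    coeff_prod_one_add_nonneg _ _ (fun i _ => by positivity) n
  have hqM : ∀ N n, q N n ≤ M := fun N n =>
    (coeff_prod_one_add_le _ _ (fun i _ => by positivity) n).trans
      (Real.exp_le_exp.2 (summable_inv_sq.sum_le_tsum _ fun n _ => by positivity))
  have hmono : ∀ n, Monotone fun N => q N n := by
    refine fun n => monotone_nat_of_le_succ fun N => ?_
    simp only [q, ← Finset.insert_Icc_right_eq_Icc_add_one (show 1 ≤ N + 1 by lia)]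
    rw [prod_insert (by simp), add_mul, one_mul, map_add, mul_assoc, PowerSeries.coeff_C_mul,
      le_add_iff_nonneg_right]
    refine mul_nonneg (by positivity) ?_
    rcases n with _ | n
    · simp
    · rw [PowerSeries.coeff_succ_X_mul]
      exact hq0 N n
  have hlim : ∀ n, ∃ L, Tendsto (fun N => q N n) atTop (𝓝 L) := fun n =>
    ⟨_, tendsto_atTop_ciSup (hmono n) ⟨M, by rintro _ ⟨N, rfl⟩; exact hqM N n⟩⟩
  choose L hL using hlim
  have hLM : ∀ n, |(-1) ^ n * L n| ≤ M := fun n => by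
    rw [abs_mul, abs_pow, abs_neg, abs_one, one_pow, one_mul, abs_of_nonneg
      (ge_of_tendsto' (hL n) fun N => hq0 N n)]
    exact le_of_tendsto' (hL n) fun N => hqM N n
  have hsum : ∀ x : ℝ, 0 < x → x < 1 → HasSum (fun n => ((-1) ^ n * L n) * x ^ n)
      (Real.sin (Real.pi * √x) / (Real.pi * √x)) := by
    intro x h0 h1
    have hg : Summable fun n => M * x ^ n := (summable_geometric_of_lt_one h0.le h1).mul_left M
    have ht := tendsto_tsum_of_dominated_convergence (𝓕 := atTop)
      (f := fun N n => q N n * (-x) ^ n) (g := fun n => ((-1) ^ n * L n) * x ^ n) hg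
      (fun n => by
        have := (hL n).mul_const ((-x) ^ n)
        rw [neg_pow, ← mul_assoc, mul_comm (L n)] at this
        simpa only [neg_pow x n] using this)
      (Eventually.of_forall fun N n => by
        rw [norm_mul, norm_pow, norm_neg, Real.norm_of_nonneg (hq0 N n), Real.norm_of_nonneg h0.le]
        exact mul_le_mul_of_nonneg_right (hqM N n) (by positivity))
    have hN : ∀ N, ∑' n, q N n * (-x) ^ n = ∏ i ∈ Icc 1 N, (1 - ((i : ℕ) : ℝ)⁻¹ ^ 2 * √x ^ 2) := by
      intro N
      rw [(hasSum_coeff_prod_one_add (Icc 1 N) (fun i => ((i : ℕ) : ℝ)⁻¹ ^ 2) (-x)).tsum_eq,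
        Real.sq_sqrt h0.le]
      exact prod_congr rfl fun i _ => by ring
    simp only [hN] at ht
    have := tendsto_nhds_unique ht (tendsto_prod_one_sub (Real.sqrt_pos.2 h0).ne')
    rw [← this]
    refine (Summable.of_norm_bounded hg fun n => ?_).hasSum
    rw [norm_mul, norm_pow, Real.norm_of_nonneg h0.le]
    exact mul_le_mul_of_nonneg_right (hLM n) (by positivity)
  have hs : ∃ B, ∀ n, |sincCoeff n| ≤ B := by
    have h := (hasSum_sincCoeff one_ne_zero).summable.norm
    refine ⟨∑' n, ‖sincCoeff n * (1 ^ 2) ^ n‖, fun n => ?_⟩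
    simpa using h.le_tsum n fun m _ => norm_nonneg _
  obtain ⟨B, hB⟩ := hs
  have key := eq_zero_of_hasSum_pow_zero (d := fun n => (-1) ^ n * L n - sincCoeff n) (M := M + B)
    (fun n => (abs_sub _ _).trans (add_le_add (hLM n) (hB n)))
    (fun x h0 h1 => by
      have h := (hsum x h0 h1).sub (hasSum_sincCoeff (Real.sqrt_pos.2 h0).ne')
      rw [sub_self, Real.sq_sqrt h0.le] at h
      simpa only [sub_mul] using h) n
  rw [← sub_eq_zero.1 key]
  simp only [coeff_prod_one_sub]
  exact (hL n).const_mul _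

/-! ### Recurrence in the depth -/

/-- The generating function `∑ E(2 n, k) X ^ n` of the even multiple zeta sums of depth `k`. -/
noncomputable def evenMZVSeries (k : ℕ) : ℝ⟦X⟧ :=
  PowerSeries.mk fun n => evenMZVSum (2 * n) k

theorem coeff_evenMZVSeries_mul_sinc (n k : ℕ) :
    PowerSeries.coeff n (evenMZVSeries k * PowerSeries.mk sincCoeff) =
      (-1) ^ k * (n.choose k : ℝ) * sincCoeff n := by
  have h1 := (tendsto_coeff_prod_one_sub n).const_mul ((-1) ^ k * (n.choose k : ℝ))
  have h2 := tendsto_finsetSum (antidiagonal n) fun p _ =>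
    (tendsto_evenMZVSum p.1 k).mul (tendsto_coeff_prod_one_sub p.2)
  simp only [← PowerSeries.coeff_mul, coeff_sum_prod_geomTail_mul] at h2
  rw [tendsto_nhds_unique h1 h2, PowerSeries.coeff_mul]
  simp [evenMZVSeries]

theorem sincCoeff_succ (n : ℕ) :
    (2 * n + 2) * (2 * n + 3) * sincCoeff (n + 1) = -(Real.pi ^ 2 * sincCoeff n) := by
  have h : (2 * (n + 1) + 1).factorial = (2 * n + 3) * ((2 * n + 2) * (2 * n + 1).factorial) := rfl
  rw [sincCoeff, sincCoeff, h]
  push_cast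
  field_simp
  ring

theorem sinc_ne_zero : (PowerSeries.mk sincCoeff : ℝ⟦X⟧) ≠ 0 := fun h => by
  simpa [sincCoeff] using congrArg (PowerSeries.coeff 0) h

/-- After multiplication by sinc, both sides are explicit. The combination is chosen so that the
binomials collapse to `(n + 1) * (n + 3/2) * n.choose k`, a quarter of the factor in
`sincCoeff_succ` times `n.choose k`. -/
theorem evenMZVSeries_recurrence (k : ℕ) :
    PowerSeries.C ((k + 2) * (k + 1) : ℝ) * evenMZVSeries (k + 2) +
        PowerSeries.C (Real.pi ^ 2 / 4) * (PowerSeries.X * evenMZVSeries k) =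
      PowerSeries.C ((k + 3 / 2) * (k + 1) : ℝ) * evenMZVSeries (k + 1) := by
  refine mul_right_cancel₀ sinc_ne_zero ?_
  ext n
  rw [add_mul]
  simp only [mul_assoc, map_add, PowerSeries.coeff_C_mul, coeff_evenMZVSeries_mul_sinc]
  rcases n with _ | n
  · simp
  · rw [PowerSeries.coeff_succ_X_mul, coeff_evenMZVSeries_mul_sinc]
    have h1 : ((n + 1).choose (k + 1) : ℝ) * (k + 1) = (n + 1) * n.choose k := by
      exact_mod_cast (Nat.add_one_mul_choose_eq n k).symm
    have h2 : ((n + 1).choose (k + 2) : ℝ) * (k + 2) = (n + 1).choose (k + 1) * (n - k) := by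
      rcases le_or_gt k n with h | h
      · have := Nat.choose_succ_right_eq (n + 1) (k + 1)
        rw [Nat.add_sub_add_right] at this
        rw [← Nat.cast_sub h]
        exact_mod_cast this
      · simp [Nat.choose_eq_zero_of_lt (show n + 1 < k + 2 by lia),
          Nat.choose_eq_zero_of_lt (show n + 1 < k + 1 by lia)]
    have h3 := sincCoeff_succ n
    have h4 : Real.pi ^ 2 * sincCoeff n = -((2 * n + 2) * (2 * n + 3) * sincCoeff (n + 1)) := by
      linarith
    linear_combination (-1) ^ k * (k + 1) * sincCoeff (n + 1) * h2 +
      (-1) ^ k * (n + 3 / 2) * sincCoeff (n + 1) * h1 + (-1) ^ k * n.choose k / 4 * h4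

theorem evenMZVSum_zero_depth {n : ℕ} (hn : n ≠ 0) : evenMZVSum (2 * n) 0 = 0 := by
  refine sum_eq_zero fun i hi => absurd ?_ hn
  have := (Finset.Nat.mem_antidiagonalTuple.1 (mem_filter.1 hi).1)
  simpa using this.symm

theorem evenMZVSum_recurrence (n k : ℕ) :
    (k + 2) * (k + 1) * evenMZVSum (2 * (n + 1)) (k + 2) =
      (k + 3 / 2) * (k + 1) * evenMZVSum (2 * (n + 1)) (k + 1) -
        Real.pi ^ 2 / 4 * evenMZVSum (2 * n) k := by
  have h := congrArg (PowerSeries.coeff (n + 1)) (evenMZVSeries_recurrence k)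
  simp only [map_add, PowerSeries.coeff_C_mul, PowerSeries.coeff_succ_X_mul, evenMZVSeries,
    PowerSeries.coeff_mk] at h
  linarith

theorem evenMZVSum_one_depth {n : ℕ} (hn : n ≠ 0) :
    (evenMZVSum (2 * n) 1 : ℂ) = riemannZeta (2 * n) := by
  have hs : Summable fun i : ℕ => 1 / (i : ℝ) ^ (2 * n) :=
    Real.summable_one_div_nat_pow.2 (by lia)
  have h1 : Tendsto (fun N => ∑ i ∈ Icc 1 N, 1 / ((i : ℕ) : ℝ) ^ (2 * n)) atTop
      (𝓝 (∑' i : ℕ, 1 / (i : ℝ) ^ (2 * n))) := by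
    refine (hs.hasSum.tendsto_sum_nat.comp (tendsto_add_atTop_nat 1)).congr fun N => ?_
    refine (sum_subset (fun i hi => by simp at hi ⊢; lia) fun i hi hi' => ?_).symm
    -- The extra term at `i = 0` vanishes because `1 / 0 = 0`.
    have : i = 0 := by simp at hi hi'; lia
    simp [this, hn]
  have h2 := tendsto_evenMZVSum n 1
  have h3 : ∀ N, PowerSeries.coeff n
      (∑ T ∈ (Icc 1 N).powersetCard 1, ∏ i ∈ T, geomTail (((i : ℕ) : ℝ)⁻¹ ^ 2)) =
        ∑ i ∈ Icc 1 N, 1 / ((i : ℕ) : ℝ) ^ (2 * n) := fun N => by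
    rw [powersetCard_one, sum_map, map_sum]
    refine sum_congr rfl fun i _ => ?_
    simp [geomTail, hn, pow_mul]
  simp only [h3] at h2
  have hz := zeta_nat_eq_tsum_of_gt_one (k := 2 * n) (by lia)
  push_cast at hz
  rw [tendsto_nhds_unique h2 h1, hz]
  push_cast
  rfl

/-! ### Solving the recurrence -/

/-- The coefficient of `ζ(2 n - 2 j)` in the expansion of the even multiple zeta sum
`E(2 n, k)`. -/
noncomputable def evenMZVCoeff (k j : ℕ) : ℝ :=
  (-1) ^ j * Real.pi ^ (2 * j) * 4 ^ j * 4 * (2 * k - 2 * j - 1).choose k /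
    (4 ^ k * (2 * j + 1).factorial)

theorem evenMZVCoeff_zero_recurrence (k : ℕ) :
    (k + 2) * (k + 1) * evenMZVCoeff (k + 2) 0 =
      (k + 3 / 2) * (k + 1) * evenMZVCoeff (k + 1) 0 := by
  have h1 := Nat.add_one_mul_choose_eq (2 * k + 2) (k + 1)
  have h2 := Nat.choose_succ_right_eq (2 * k + 1) (k + 1)
  have h3 := Nat.choose_succ_succ (2 * k + 1) k
  have h4 := Nat.choose_symm_half k
  have e1 : 2 * (k + 2) - 2 * 0 - 1 = 2 * k + 3 := by lia
  have e2 : 2 * (k + 1) - 2 * 0 - 1 = 2 * k + 1 := by lia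
  have h : ((2 * k + 3).choose (k + 2) : ℝ) * (k + 2) =
      (2 * k + 3) * (2 * (2 * k + 1).choose (k + 1)) := by
    have : (2 * k + 3).choose (k + 2) * (k + 2) =
      (2 * k + 3) * (2 * (2 * k + 1).choose (k + 1)) := by
      rw [← h1, h3, ← h4]
      ring
    exact_mod_cast this
  rw [evenMZVCoeff, evenMZVCoeff, e1, e2]
  simp only [pow_succ, mul_zero, pow_zero]
  field_simp
  linear_combination 2 * h

theorem evenMZVCoeff_succ_recurrence {k j : ℕ} (hj : j < k) :
    (k + 2) * (k + 1) * evenMZVCoeff (k + 2) (j + 1) =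
      (k + 3 / 2) * (k + 1) * evenMZVCoeff (k + 1) (j + 1) -
        Real.pi ^ 2 / 4 * evenMZVCoeff k j := by
  obtain ⟨M, hM⟩ : ∃ M, 2 * k = M + 2 * j + 1 := ⟨2 * k - 2 * j - 1, by lia⟩
  have e1 : 2 * (k + 2) - 2 * (j + 1) - 1 = M + 2 := by lia
  have e2 : 2 * (k + 1) - 2 * (j + 1) - 1 = M := by lia
  have e3 : 2 * k - 2 * j - 1 = M := by lia
  have h1 : ((M + 2).choose (k + 2) : ℝ) * (k + 2) = (M + 2) * (M + 1).choose (k + 1) := by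
    exact_mod_cast (Nat.add_one_mul_choose_eq (M + 1) (k + 1)).symm
  have h2 : ((M + 1).choose (k + 1) : ℝ) * (k + 1) = (M + 1) * M.choose k := by
    exact_mod_cast (Nat.add_one_mul_choose_eq M k).symm
  have h3 : (M.choose (k + 1) : ℝ) * (k + 1) = M.choose k * (M - k) := by
    rcases le_or_gt k M with h | h
    · rw [← Nat.cast_sub h]
      exact_mod_cast Nat.choose_succ_right_eq M k
    · simp [Nat.choose_eq_zero_of_lt h, Nat.choose_eq_zero_of_lt (h.trans (Nat.lt_succ_self k))]
  have hf : (2 * (j + 1) + 1).factorial = (2 * j + 3) * ((2 * j + 2) * (2 * j + 1).factorial) := rfl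
  have hM' : (2 * k : ℝ) = M + 2 * j + 1 := by exact_mod_cast hM
  have hj' : (j : ℝ) = k - M / 2 - 1 / 2 := by linarith
  rw [evenMZVCoeff, evenMZVCoeff, evenMZVCoeff, e1, e2, e3, hf]
  simp only [pow_succ, mul_add, mul_one]
  push_cast
  -- The recurrence with powers of `π`, powers of 4 and factorials cleared; `hj'` eliminates `j`.
  have hk : ((k + 2) * (k + 1) * (M + 2).choose (k + 2) : ℝ) =
      (4 * k + 6) * ((k + 1) * M.choose (k + 1)) + (2 * j + 2) * (2 * j + 3) * M.choose k := by
    rw [hj']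
    linear_combination (k + 1) * h1 + (M + 2) * h2 - (4 * k + 6) * h3
  field_simp
  linear_combination (-2) * hk

theorem evenMZVCoeff_eq_zero {k j : ℕ} (hk : 1 ≤ k) (hj : k - 1 < 2 * j) :
    evenMZVCoeff k j = 0 := by
  rw [evenMZVCoeff, Nat.choose_eq_zero_of_lt (by lia)]
  simp

theorem evenMZVSum_eq_sum (k : ℕ) : ∀ n, k + 1 ≤ n →
    evenMZVSum (2 * n) (k + 1) =
      ∑ j ∈ range (k + 1), evenMZVCoeff (k + 1) j * evenMZVSum (2 * (n - j)) 1 := by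
  have hstep : ∀ k n : ℕ,
      ∑ j ∈ range (k + 2), (k + 2) * (k + 1) * evenMZVCoeff (k + 2) j *
          evenMZVSum (2 * (n + 1 - j)) 1 =
        ∑ j ∈ range (k + 1), (k + 3 / 2) * (k + 1) * evenMZVCoeff (k + 1) j *
            evenMZVSum (2 * (n + 1 - j)) 1 -
          Real.pi ^ 2 / 4 * ∑ j ∈ range k, evenMZVCoeff k j * evenMZVSum (2 * (n - j)) 1 := by
    intro k n
    -- The top coefficient `j = k + 1` vanishes, so the ranges agree; `j = 0` is split off because
    -- depth `k` contributes only to indices `j + 1`.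
    rw [sum_range_succ, evenMZVCoeff_eq_zero (by lia : 1 ≤ k + 2) (by lia), sum_range_succ',
      sum_range_succ', evenMZVCoeff_zero_recurrence, mul_sum, mul_zero, zero_mul, add_zero,
      add_sub_right_comm, ← sum_sub_distrib]
    congr 1
    refine sum_congr rfl fun j hj => ?_
    rw [evenMZVCoeff_succ_recurrence (mem_range.1 hj), Nat.add_sub_add_right]
    ring
  induction k using Nat.strong_induction_on with
  | _ k ih =>
    intro n hn
    obtain ⟨n, rfl⟩ : ∃ m, n = m + 1 := ⟨n - 1, by lia⟩
    rcases k with _ | k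
    · simp [evenMZVCoeff]
    have hpos : ((k : ℝ) + 2) * (k + 1) ≠ 0 := by positivity
    refine mul_left_cancel₀ hpos ?_
    rw [mul_sum]
    simp only [← mul_assoc]
    rw [evenMZVSum_recurrence, ih k (by lia) (n + 1) (by lia)]
    rw [show k + 1 + 1 = k + 2 from rfl, hstep k n, mul_sum]
    simp only [← mul_assoc]
    congr 2
    -- The recurrence reaches down to depth 0, where `E(2n, 0) = 0` for `n ≠ 0` matches the empty
    -- sum.
    rcases k with _ | k
    · simpa using evenMZVSum_zero_depth (show n ≠ 0 by lia)
    · exact ih k (by lia) n (by lia)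

theorem evenMZVCoeff_eq_bernoulli {k j : ℕ} (hk : 2 ≤ k) (hj : j ≠ 0) :
    (evenMZVCoeff k j : ℂ) =
      -(1 / (2 ^ (2 * k - 3) * (2 * (j : ℂ) + 1) * ((bernoulli (2 * j) : ℚ) : ℂ)) *
        (Nat.choose (2 * k - 2 * j - 1) k : ℂ) * riemannZeta (2 * (j : ℂ))) := by
  -- Nonvanishing of `ζ(2j)` is what shows, through Euler's formula, that `B_{2j} ≠ 0`.
  have hz : riemannZeta (2 * j) ≠ 0 :=
    riemannZeta_ne_zero_of_one_le_re (by norm_cast; lia)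
  rw [riemannZeta_two_mul_nat hj] at hz ⊢
  have hb : ((bernoulli (2 * j) : ℚ) : ℂ) ≠ 0 := fun h => hz (by simp [h])
  obtain ⟨k, rfl⟩ : ∃ m, k = m + 2 := ⟨k - 2, by lia⟩
  obtain ⟨j, rfl⟩ : ∃ m, j = m + 1 := ⟨j - 1, by lia⟩
  have e1 : 2 * (k + 2) - 3 = 2 * k + 1 := by lia
  have e2 : 2 * (j + 1) - 1 = 2 * j + 1 := by lia
  have hj0 : (2 * ((j + 1 : ℕ) : ℂ) + 1) ≠ 0 := by norm_cast
  have hpk : (2 : ℂ) ^ (2 * k + 1) = 2 * 4 ^ k := by rw [pow_succ, pow_mul]; norm_num; ring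
  have hpj : (2 : ℂ) ^ (2 * j + 1) = 2 * 4 ^ j := by rw [pow_succ, pow_mul]; norm_num; ring
  have hf0 : ((2 * (j + 1)).factorial : ℂ) ≠ 0 := by exact_mod_cast Nat.factorial_ne_zero _
  rw [evenMZVCoeff, e1, e2, hpk, hpj, Nat.factorial_succ (2 * (j + 1))]
  push_cast at hj0 ⊢
  field_simp
  ring

theorem theorem1 (n k : ℕ) (hk : 1 ≤ k) (hkn : k ≤ n) :
    (∀ i ∈ evenArguments (2 * n) k, Summable (mzvTerm i)) ∧
    (evenMZVSum (2 * n) k : ℂ) =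
      1 / 2 ^ (2 * (k - 1)) * (Nat.choose (2 * k - 1) k : ℂ) * riemannZeta (2 * (n : ℂ)) -
        ∑ j ∈ Finset.Icc 1 ((k - 1) / 2),
          1 / (2 ^ (2 * k - 3) * (2 * (j : ℂ) + 1) * ((bernoulli (2 * j) : ℚ) : ℂ)) *
            (Nat.choose (2 * k - 2 * j - 1) k : ℂ) *
            riemannZeta (2 * (j : ℂ)) * riemannZeta (2 * (n : ℂ) - 2 * (j : ℂ)) := by
  refine ⟨fun i hi => summable_mzvTerm (two_le_of_mem_evenArguments hi), ?_⟩
  obtain ⟨k, rfl⟩ : ∃ m, k = m + 1 := ⟨k - 1, by lia⟩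
  rw [evenMZVSum_eq_sum k n hkn, sum_range_succ', add_comm, sub_eq_add_neg]
  push_cast
  congr 1
  · rw [tsub_zero, evenMZVSum_one_depth (by lia), evenMZVCoeff]
    congr 1
    have hpk : (2 : ℂ) ^ (2 * k) = 4 ^ k := by rw [pow_mul]; norm_num
    rw [hpk, pow_succ]
    push_cast
    field_simp
    simp
  · rw [← sum_neg_distrib, range_eq_Ico]
    rw [sum_Ico_add'
      (fun j => (evenMZVCoeff (k + 1) j : ℂ) * (evenMZVSum (2 * (n - j)) 1 : ℂ)) 0 k 1]
    -- Indices beyond `k / 2` carry zero coefficients. The rest satisfy `1 ≤ j ≤ k / 2`, so the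
    -- depth `k + 1` is at least 3 and the exponent `2 * (k + 1) - 3` is not truncated.
    refine (sum_subset (fun j hj => ?_) fun j hj hj' => ?_).symm.trans
      (sum_congr rfl fun j hj => ?_)
    · simp only [mem_Icc, mem_Ico] at hj ⊢
      lia
    · rw [evenMZVCoeff_eq_zero hk, Complex.ofReal_zero, zero_mul]
      simp only [mem_Icc, mem_Ico] at hj hj'
      lia
    · simp only [mem_Icc] at hj
      rw [evenMZVCoeff_eq_bernoulli (by lia) (by lia), evenMZVSum_one_depth (by lia),
        Nat.cast_sub (by lia), mul_sub, neg_mul]
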